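/- Let $1\le d_s\le d$ be integers, $\mathcal D=\{1,\dots,d\}$, and $U_{d_s}=\{u\subset\mathcal D:\ |u|\le d_s\}$. For positive integers $N_1,\dots,N_{d_s}$ let $$\mathcal I=\{0\}\cup\bigcup_{\emptyset\ne u\in U_{d_s}}\{k\in\mathbb N_0^d:\ \operatorname{supp}k=u,\ \|k\|_\infty\le N_{|u|}-1\},$$ and put $N_{\max}=\max_{1\le j\le d_s}N_j$. Let $\omega(x)=\prod_{s=1}^d\frac1{\pi\sqrt{1-x_s^2}}$ be the Chebyshev product density on $[-1,1]^d$, $T_k(x)=\sqrt2^{\,|\operatorname{supp}k|}\prod_{s\in\operatorname{supp}k}\cos(k_s\arccos x_s)$ the normed Chebyshev polynomials, and, for nodes $X=(x_1,\dots,x_M)$ in $[-1,1]^d$, $M=|X|\ge1$, let $F(X)=(T_k(x_i))_{1\le i\le M,\,k\in\mathcal I}$. Consider for $y\in\mathbb R^M$ the least-squares problems (i) $\min_{h}\|y-F(X)h\|_2^2$, (ii) $\min_{h}\|Wy-WF(\tilde X)h\|_2^2$, where $0<\theta<1$, $\tilde X=(1-\theta)X$ and $W=\operatorname{diag}\big(\sqrt{\omega(\tilde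 x_i)}\big)_{i=1}^M$. Each iteration of the matrix-free LSQR algorithm of Paige and Saunders for (i) or (ii), where products with $F$ and $F^\top$ are computed up to a prescribed accuracy (as is done with the nonequispaced fast cosine transform and its adjoint), has arithmetic complexity $$\mathcal O\Big(d^{d_s}\big(N_{\max}^{d_s}\log N_{\max}+|X|\big)\Big),$$ with a constant depending only on $d_s$ and the accuracy. Precisely: for all $d_s\ge1$ and $\varepsilon>0$ there is a constant $C$ such that for all $d\ge d_s$, all $N_1,\dots,N_{d_s}\ge1$, all $M\ge1$ and all nodes $X$ in $[-1,1]^d$ the following holds. In case (i), there are a real matrix $G$ with $|G_{i,k}-F(X)_{i,k}|\le\varepsilon$ for all $i,k$ and a straight-line program of at most $C\,d^{d_s}\big(N_{\max}^{d_s}\log N_{\max}+M\big)$ instructions such that, for every $y\in\mathbb R^M$ and every $t\ge0$, the program maps the state of LSQR for $\min_h\|y-Gh\|_2$ after $t$ iterations to its state after $t+1$ iterations. In case (ii), for every $\theta\in(0,1)$, the same holds, with the same $C$, for a matrix $G$ with $|G_{i,k}-F(\tilde X)_{i,k}|\le\varepsilon$ and LSQR for $\min_h\|Wy-WGh\|_2$.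 Here an instruction is an operation $+,-,\cdot,/,\sqrt{\ }$ on real numbers or the loading of a constant; the constants may depend on $X$, the $N_j$, $\theta$, $\varepsilon$ (they are precomputed) but not on $y$ or on the iteration. The state of LSQR consists of its two bidiagonalization vectors, the search direction, the current solution, and the scalars $\alpha,\bar\rho,\bar\varphi$; quotients by $0$ are read as $0$ (in particular zero vectors are normalized to zero). -/

import Mathlib

open scoped Matrix

noncomputable section

namespace AnovaLSQR

/-! ### Index sets, the Chebyshev system and the least-squares matrices -/

/-- The family of all sets of coordinates of order at most `ds`. -/
def termsUpTo (d ds : ℕ) : Finset (Finset (Fin d)) :=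
  Finset.univ.filter fun u => u.card ≤ ds

/-- The frequencies with support exactly `u` and entries at most `Nu - 1`
(for `u = ∅` this is `{0}`). -/
def termIndex {d : ℕ} (u : Finset (Fin d)) (Nu : ℕ) : Finset (Fin d → ℕ) :=
  Fintype.piFinset fun s => if s ∈ u then Finset.Icc 1 (Nu - 1) else {0}

theorem mem_termIndex {d : ℕ} {u : Finset (Fin d)} {Nu : ℕ} (hN : 1 ≤ Nu) {k : Fin d → ℕ} :
    k ∈ termIndex u Nu ↔ (∀ s, k s ≠ 0 ↔ s ∈ u) ∧ ∀ s, k s ≤ Nu - 1 := by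
  simp only [termIndex, Fintype.mem_piFinset]
  constructor
  · intro h
    refine ⟨fun s => ?_, fun s => ?_⟩ <;> have hs := h s <;> by_cases hu : s ∈ u <;>
      simp only [hu, if_true, if_false, Finset.mem_Icc, Finset.mem_singleton] at hs <;> grind
  · rintro ⟨h1, h2⟩ s
    have a := h1 s
    have b := h2 s
    by_cases hu : s ∈ u <;>
      simp only [hu, if_true, if_false, Finset.mem_Icc, Finset.mem_singleton] <;> grind

/-- The grouped index set of a family `U` of ANOVA terms with parameters `N u`, `u ∈ U`. -/
def groupedIndex {d : ℕ} (U : Finset (Finset (Fin d))) (N : Finset (Fin d) → ℕ) :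
    Finset (Fin d → ℕ) :=
  U.biUnion fun u => termIndex u (N u)

/-- The grouped index set of all terms of order at most `ds`, with order-dependent parameters
`N_u = N_{|u|}`. -/
def orderIndex (d ds : ℕ) (N : ℕ → ℕ) : Finset (Fin d → ℕ) :=
  groupedIndex (termsUpTo d ds) fun u => N u.card

/-- The normed tensor-product Chebyshev polynomials of the first kind. -/
def cheb {d : ℕ} (k : Fin d → ℕ) (x : Fin d → ℝ) : ℝ :=
  √2 ^ (Finset.univ.filter fun s => k s ≠ 0).card *
    ∏ s ∈ Finset.univ.filter (fun s => k s ≠ 0), Real.cos (k s * Real.arccos (x s))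

/-- The Chebyshev product density. -/
def chebDensity {d : ℕ} (x : Fin d → ℝ) : ℝ :=
  ∏ s, 1 / (Real.pi * √(1 - x s ^ 2))

/-- The system matrix `(T_k(x))`, rows indexed by the nodes and columns by the frequencies. -/
def systemMatrix {d M : ℕ} (x : Fin M → Fin d → ℝ) (I : Finset (Fin d → ℕ)) :
    Matrix (Fin M) I ℝ :=
  fun i k => cheb k (x i)

/-- The nodes scaled from `[-1,1]^d` into `[-1+θ,1-θ]^d`. -/
def scaledNodes {d M : ℕ} (θ : ℝ) (x : Fin M → Fin d → ℝ) : Fin M → Fin d → ℝ :=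
  fun i s => (1 - θ) * x i s

/-- The diagonal preconditioner `diag(√ω(x))`. -/
def precond {d M : ℕ} (x : Fin M → Fin d → ℝ) : Matrix (Fin M) (Fin M) ℝ :=
  Matrix.diagonal fun i => √(chebDensity (x i))

/-! ### The LSQR algorithm of Paige and Saunders -/

/-- Euclidean norm of a vector. -/
def norm2 {ι : Type} [Fintype ι] (a : ι → ℝ) : ℝ := √(∑ i, a i ^ 2)

/-- What LSQR carries from one iteration to the next for the problem `min ‖b - A h‖₂`: the
bidiagonalization vectors `u`, `v`, the search direction `w`, the current solution `h` and
the scalars `α`, `ρ̄`, `φ̄`. -/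
structure LSQRState (m n : Type) where
  u : m → ℝ
  v : n → ℝ
  w : n → ℝ
  h : n → ℝ
  alpha : ℝ
  rhoBar : ℝ
  phiBar : ℝ

variable {m n : Type} [Fintype m] [Fintype n]

/-- Initialization: `β₁ u₁ = b`, `α₁ v₁ = Aᵀ u₁`, `w₁ = v₁`, `h₀ = 0`, `φ̄₁ = β₁`, `ρ̄₁ = α₁`.
A zero vector is normalized to the zero vector. -/
def lsqrInit (A : Matrix m n ℝ) (b : m → ℝ) : LSQRState m n :=
  let β := norm2 b
  let u : m → ℝ := fun i => b i / β
  let q : n → ℝ := Aᵀ *ᵥ u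
  let α := norm2 q
  let v : n → ℝ := fun k => q k / α
  { u := u, v := v, w := v, h := 0, alpha := α, rhoBar := α, phiBar := β }

/-- One iteration of LSQR: a bidiagonalization step, a plane rotation, and the updates of the
solution and of the search direction. -/
def lsqrStep (A : Matrix m n ℝ) (S : LSQRState m n) : LSQRState m n :=
  let p : m → ℝ := fun i => (A *ᵥ S.v) i - S.alpha * S.u i
  let β := norm2 p
  let u : m → ℝ := fun i => p i / β
  let q : n → ℝ := fun k => (Aᵀ *ᵥ u) k - β * S.v k
  let α := norm2 q
  let v : n → ℝ := fun k => q k / α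
  let ρ := √(S.rhoBar ^ 2 + β ^ 2)
  let c := S.rhoBar / ρ
  let s := β / ρ
  let θ := s * α
  let φ := c * S.phiBar
  { u := u
    v := v
    w := fun k => v k - θ / ρ * S.w k
    h := fun k => S.h k + φ / ρ * S.w k
    alpha := α
    rhoBar := -c * α
    phiBar := s * S.phiBar }

/-- The state of LSQR for `min ‖b - A h‖₂` after `t` iterations. -/
def lsqr (A : Matrix m n ℝ) (b : m → ℝ) : ℕ → LSQRState m n
  | 0 => lsqrInit A b
  | t + 1 => lsqrStep A (lsqr A b t)

/-- The individual real numbers that make up a state. -/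
inductive LSQRCell (m n : Type) where
  | u (i : m)
  | v (k : n)
  | w (k : n)
  | h (k : n)
  | alpha
  | rhoBar
  | phiBar

/-- The real number stored in a cell of a state. -/
def LSQRState.read {m n : Type} (S : LSQRState m n) : LSQRCell m n → ℝ
  | .u i => S.u i
  | .v k => S.v k
  | .w k => S.w k
  | .h k => S.h k
  | .alpha => S.alpha
  | .rhoBar => S.rhoBar
  | .phiBar => S.phiBar

/-! ### Arithmetic complexity: straight-line programs over the reals -/

/-- Operands: an input, or the result of the instruction at a given position of the program. -/
inductive Operand (ι : Type) where
  | input (i : ι)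
  | reg (r : ℕ)

/-- Elementary instructions. Constants are fixed in the program, that is, precomputed. -/
inductive Instr (ι : Type) where
  | const (c : ℝ)
  | add (a b : Operand ι)
  | sub (a b : Operand ι)
  | mul (a b : Operand ι)
  | div (a b : Operand ι)
  | sqrt (a : Operand ι)

/-- Value of an operand, given the inputs and the results so far (a result that has not been
computed reads as `0`). -/
def Operand.value {ι : Type} (inp : ι → ℝ) (regs : List ℝ) : Operand ι → ℝ
  | .input i => inp i
  | .reg r => regs.getD r 0

/-- Result of one instruction. -/
def Instr.value {ι : Type} (inp : ι → ℝ) (regs : List ℝ) : Instr ι → ℝ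
  | .const c => c
  | .add a b => a.value inp regs + b.value inp regs
  | .sub a b => a.value inp regs - b.value inp regs
  | .mul a b => a.value inp regs * b.value inp regs
  | .div a b => a.value inp regs / b.value inp regs
  | .sqrt a => √(a.value inp regs)

/-- Execute instructions in order, appending each result to the list of results. -/
def exec {ι : Type} (inp : ι → ℝ) : List (Instr ι) → List ℝ → List ℝ
  | [], regs => regs
  | c :: cs, regs => exec inp cs (regs ++ [c.value inp regs])

/-- A straight-line program with inputs indexed by `ι` and outputs indexed by `κ`. -/
structure Program (ι κ : Type) where
  code : List (Instr ι)
  out : κ → Operand ι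

/-- The function computed by a program. -/
def Program.eval {ι κ : Type} (P : Program ι κ) (inp : ι → ℝ) : κ → ℝ :=
  fun o => (P.out o).value inp (exec inp P.code [])

/-- The number of elementary instructions, loading a constant included. -/
def Program.cost {ι κ : Type} (P : Program ι κ) : ℕ := P.code.length

/-- `P` carries out every iteration of LSQR for the matrix `A` and the right-hand side `b`. -/
def Program.PerformsLSQR {m n : Type} [Fintype m] [Fintype n]
    (P : Program (LSQRCell m n) (LSQRCell m n)) (A : Matrix m n ℝ) (b : m → ℝ) : Prop :=
  ∀ t : ℕ, P.eval (lsqr A b t).read = (lsqr A b (t + 1)).read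

end AnovaLSQR

end

/-!
The prescribed accuracy may enter the constant, so the system matrix can be replaced by the exact
Chebyshev system at nodes rounded to a fine grid. If the angle `arccos x_s` is moved to the nearest
smaller multiple of `2π/n`, every factor `cos (k_s arccos x_s)` with `k_s < Nmax` changes by at most
`2π Nmax / n`, so that `n ≥ K * Nmax` with `K` depending on `ds` and `ε` makes the entrywise error
at most `ε` (`exists_fastMul_near_systemMatrix`). This is the nonequispaced cosine transform with
the simplest window, a nearest-point rule, the oversampling factor `K` providing the accuracy.

On the grid, each ANOVA term `u` is a tensor power of order `|u| ≤ ds` of one cosine matrix of size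
`n = 2 ^ r`. This matrix is applied in `O(n log n)` operations by halving: at the angles
`(a + 2πl) / (2n)` the polynomial `T_n` takes only the two values `± cos (a / 2)`, so a Chebyshev
expansion of length `2n` is reduced modulo `T_n` minus either value, three terms for each new
coefficient, and two transforms of size `n` remain (`cosMatrix_two_mul`, `fastMul_cosMatrix`).
Evaluating dimension by dimension gives `O(n ^ ds log n)` for each term
(`FastMul.tensorPow`), there are at most `(d + 1) ^ ds` terms, and collecting the results
at the `M` nodes costs a bounded number of operations for each node and term.

All these matrices are built from sparse ones by products, block-diagonal sums and renumbering
(`FastMul`), a class that is closed under transposition with the same cost; hence the adjoint is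
covered as well. The passage to straight-line programs (`FastMul.reach_mulVec`) and the cost of an
LSQR iteration, two products plus a number of operations linear in the size of the state
(`exists_program_lsqr`), are counted in a calculus of sets of functions computable from each other
(`Reach`).
-/

noncomputable section

namespace AnovaLSQR

/-! ### Straight-line computations -/

section StraightLine

variable {ι : Type}

theorem exec_append (inp : ι → ℝ) (cs ds : List (Instr ι)) (regs : List ℝ) :
    exec inp (cs ++ ds) regs = exec inp ds (exec inp cs regs) := by
  induction cs generalizing regs with
  | nil => rfl
  | cons c cs ih => simp [exec, ih]

theorem prefix_exec (inp : ι → ℝ) (cs : List (Instr ι)) (regs : List ℝ) :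
    regs <+: exec inp cs regs := by
  induction cs generalizing regs with
  | nil => exact List.prefix_rfl
  | cons c cs ih => exact (List.prefix_append _ _).trans (ih _)

theorem length_exec (inp : ι → ℝ) (cs : List (Instr ι)) (regs : List ℝ) :
    (exec inp cs regs).length = regs.length + cs.length := by
  induction cs generalizing regs with
  | nil => simp [exec]
  | cons c cs ih => simp [exec, ih]; omega

/-- Some operand holds the value of `f` once the code `cs` has been executed, and keeps it
whatever is executed afterwards. -/
def Available (cs : List (Instr ι)) (f : (ι → ℝ) → ℝ) : Prop :=
  ∃ o : Operand ι, ∀ inp ext, o.value inp (exec inp (cs ++ ext) []) = f inp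

theorem Available.append {cs : List (Instr ι)} {f : (ι → ℝ) → ℝ} (h : Available cs f)
    (ext : List (Instr ι)) : Available (cs ++ ext) f := by
  obtain ⟨o, ho⟩ := h
  exact ⟨o, fun inp ext' => by rw [List.append_assoc, ho]⟩

theorem available_instr (cs : List (Instr ι)) (c : Instr ι) :
    Available (cs ++ [c]) fun inp => c.value inp (exec inp cs []) := by
  refine ⟨.reg cs.length, fun inp ext => ?_⟩
  rw [exec_append, exec_append]
  obtain ⟨l, hl⟩ := prefix_exec inp ext (exec inp [c] (exec inp cs []))
  have hlen : (exec inp cs []).length = cs.length := by simp [length_exec]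
  rw [← hl]
  simp [Operand.value, exec, ← hlen]

/-- Given code after which all functions in `S` are available, at most `c` further instructions
make all functions in `T` available. -/
def Reach (S T : Set ((ι → ℝ) → ℝ)) (c : ℕ) : Prop :=
  ∀ cs : List (Instr ι), (∀ f ∈ S, Available cs f) →
    ∃ ext : List (Instr ι), ext.length ≤ c ∧ ∀ f ∈ T, Available (cs ++ ext) f

namespace Reach

variable {S S' T T' U : Set ((ι → ℝ) → ℝ)} {f g : (ι → ℝ) → ℝ} {c c' : ℕ}

theorem mono (h : Reach S T c) (hS : S ⊆ S') (hT : T' ⊆ T) (hc : c ≤ c') : Reach S' T' c' := by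
  intro cs hcs
  obtain ⟨ext, h1, h2⟩ := h cs fun f hf => hcs f (hS hf)
  exact ⟨ext, h1.trans hc, fun f hf => h2 f (hT hf)⟩

theorem of_subset (h : T ⊆ S) : Reach S T 0 :=
  fun cs hcs => ⟨[], le_rfl, fun f hf => by simpa using hcs f (h hf)⟩

theorem trans (h : Reach S T c) (h' : Reach T U c') : Reach S U (c + c') := by
  intro cs hcs
  obtain ⟨e, h1, h2⟩ := h cs hcs
  obtain ⟨e', h1', h2'⟩ := h' _ h2
  refine ⟨e ++ e', by simp; omega, fun f hf => ?_⟩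
  rw [← List.append_assoc]
  exact h2' f hf

theorem union (h : Reach S T c) (h' : Reach S T' c') : Reach S (T ∪ T') (c + c') := by
  intro cs hcs
  obtain ⟨e, h1, h2⟩ := h cs hcs
  obtain ⟨e', h1', h2'⟩ := h' (cs ++ e) fun f hf => (hcs f hf).append e
  refine ⟨e ++ e', by simp; omega, fun f hf => ?_⟩
  rw [← List.append_assoc]
  rcases hf with hf | hf
  · exact (h2 f hf).append e'
  · exact h2' f hf

theorem keep (h : Reach S T c) : Reach S (S ∪ T) c := by
  simpa using (of_subset (subset_refl S)).union h

/-- Sequential composition in which the earlier results stay available. -/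
theorem andThen (h : Reach S T c) (h' : Reach T U c') : Reach S (T ∪ U) (c + c') :=
  h.trans h'.keep

theorem biUnion {κ : Type*} (s : Finset κ) {T : κ → Set ((ι → ℝ) → ℝ)} {c : κ → ℕ}
    (h : ∀ i ∈ s, Reach S (T i) (c i)) : Reach S (⋃ i ∈ s, T i) (∑ i ∈ s, c i) := by
  classical
  induction s using Finset.induction_on with
  | empty => exact of_subset (by simp)
  | insert a s ha ih =>
    rw [Finset.set_biUnion_insert, Finset.sum_insert ha]
    exact (h a (by simp)).union (ih fun i hi => h i (by simp [hi]))

theorem range {κ : Type*} [Fintype κ] {F : κ → (ι → ℝ) → ℝ} {c : ℕ}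
    (h : ∀ i, Reach S {F i} c) : Reach S (Set.range F) (Fintype.card κ * c) := by
  refine (biUnion Finset.univ fun i _ => h i).mono subset_rfl ?_ (by simp)
  rintro _ ⟨i, rfl⟩
  simp

theorem const (a : ℝ) : Reach S {fun _ => a} 1 := by
  intro cs _
  refine ⟨[.const a], by simp, ?_⟩
  simpa [Instr.value] using available_instr cs (.const a)

theorem add (hf : f ∈ S) (hg : g ∈ S) : Reach S {fun inp => f inp + g inp} 1 := by
  intro cs hcs
  obtain ⟨a, ha⟩ := hcs f hf
  obtain ⟨b, hb⟩ := hcs g hg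
  refine ⟨[.add a b], by simp, ?_⟩
  have := available_instr cs (.add a b)
  simp only [Instr.value] at this
  simpa [← ha _ [], ← hb _ []] using this

theorem sub (hf : f ∈ S) (hg : g ∈ S) : Reach S {fun inp => f inp - g inp} 1 := by
  intro cs hcs
  obtain ⟨a, ha⟩ := hcs f hf
  obtain ⟨b, hb⟩ := hcs g hg
  refine ⟨[.sub a b], by simp, ?_⟩
  have := available_instr cs (.sub a b)
  simp only [Instr.value] at this
  simpa [← ha _ [], ← hb _ []] using this

theorem mul (hf : f ∈ S) (hg : g ∈ S) : Reach S {fun inp => f inp * g inp} 1 := by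
  intro cs hcs
  obtain ⟨a, ha⟩ := hcs f hf
  obtain ⟨b, hb⟩ := hcs g hg
  refine ⟨[.mul a b], by simp, ?_⟩
  have := available_instr cs (.mul a b)
  simp only [Instr.value] at this
  simpa [← ha _ [], ← hb _ []] using this

theorem div (hf : f ∈ S) (hg : g ∈ S) : Reach S {fun inp => f inp / g inp} 1 := by
  intro cs hcs
  obtain ⟨a, ha⟩ := hcs f hf
  obtain ⟨b, hb⟩ := hcs g hg
  refine ⟨[.div a b], by simp, ?_⟩
  have := available_instr cs (.div a b)
  simp only [Instr.value] at this
  simpa [← ha _ [], ← hb _ []] using this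

theorem sqrt (hf : f ∈ S) : Reach S {fun inp => √(f inp)} 1 := by
  intro cs hcs
  obtain ⟨a, ha⟩ := hcs f hf
  refine ⟨[.sqrt a], by simp, ?_⟩
  have := available_instr cs (.sqrt a)
  simp only [Instr.value] at this
  simpa [← ha _ []] using this

theorem sq (hf : f ∈ S) : Reach S {fun inp => f inp ^ 2} 1 := by
  simpa only [pow_two] using mul hf hf

/-- Sums are accumulated from an available zero, so that an empty sum costs nothing. -/
theorem sum {κ : Type*} (s : Finset κ) {F : κ → (ι → ℝ) → ℝ} {c : ℕ}
    (h0 : (fun _ => 0) ∈ S) (h : ∀ i ∈ s, Reach S {F i} c) :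
    Reach S {fun inp => ∑ i ∈ s, F i inp} (s.card * (c + 1)) := by
  classical
  induction s using Finset.induction_on with
  | empty =>
    refine (of_subset (S := S) ?_).mono subset_rfl subset_rfl (Nat.zero_le _)
    simpa using h0
  | insert a s ha ih =>
    simp only [Finset.sum_insert ha, Finset.card_insert_of_notMem ha]
    have h1 := (h a (by simp)).union (ih fun i hi => h i (by simp [hi]))
    refine (h1.trans (add (f := F a) (g := fun inp => ∑ i ∈ s, F i inp)
      (by simp) (by simp))).mono subset_rfl subset_rfl (le_of_eq (by ring))

theorem norm2 {κ : Type} [Fintype κ] {F : κ → (ι → ℝ) → ℝ}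
    (h0 : (fun _ => 0) ∈ S) (h : ∀ i, F i ∈ S) :
    Reach S {fun inp => norm2 fun i => F i inp} (2 * Fintype.card κ + 1) := by
  have h1 := sum Finset.univ h0 fun i _ => sq (h i)
  refine (h1.trans (sqrt rfl)).mono subset_rfl subset_rfl (le_of_eq ?_)
  rw [Finset.card_univ]; ring

/-- Inputs need no instruction, so a computation from nothing is a program. -/
theorem exists_program {κ : Type} {F : κ → (ι → ℝ) → ℝ} {c : ℕ}
    (h : Reach ((Set.range fun i inp => inp i) : Set ((ι → ℝ) → ℝ)) (Set.range F) c) :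
    ∃ P : Program ι κ, P.cost ≤ c ∧ ∀ inp, P.eval inp = fun o => F o inp := by
  obtain ⟨ext, h1, h2⟩ := h [] (by
    rintro _ ⟨i, rfl⟩
    exact ⟨.input i, fun _ _ => rfl⟩)
  choose o ho using fun k => h2 (F k) ⟨k, rfl⟩
  refine ⟨⟨ext, o⟩, h1, fun inp => ?_⟩
  funext k
  simpa [Program.eval] using ho k inp []

end Reach

end StraightLine

/-! ### Matrices with fast sparse factorizations -/

/-- `FastMul A c`: the matrix `A` is built from sparse matrices with at most `c` entries in total
by products, block-diagonal sums and renumbering of rows and columns. -/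
inductive FastMul : ∀ {m n : Type}, Matrix m n ℝ → ℕ → Prop
  | sparse {m n : Type} (A : Matrix m n ℝ) (E : Finset (m × n))
      (h : ∀ i j, A i j ≠ 0 → (i, j) ∈ E) : FastMul A E.card
  | mul {m l n : Type} [Fintype l] (A : Matrix m l ℝ) (B : Matrix l n ℝ) (a b : ℕ)
      (hA : FastMul A a) (hB : FastMul B b) : FastMul (A * B) (a + b)
  | blockDiagonal {o : Type} [Fintype o] [DecidableEq o] {m n : o → Type}
      (A : ∀ k, Matrix (m k) (n k) ℝ) (a : o → ℕ) (h : ∀ k, FastMul (A k) (a k)) :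
      FastMul (Matrix.blockDiagonal' A) (∑ k, a k)
  | reindex {m n m' n' : Type} (A : Matrix m n ℝ) (a : ℕ) (e : m' ≃ m) (f : n' ≃ n)
      (h : FastMul A a) : FastMul (A.submatrix e f) a
  | mono {m n : Type} (A : Matrix m n ℝ) (a b : ℕ) (hab : a ≤ b) (h : FastMul A a) : FastMul A b

namespace FastMul

variable {m n l p q : Type} {a b c : ℕ}

/-- Transposing every factor costs nothing, so the adjoint is as fast as the matrix itself. -/
theorem transpose {A : Matrix m n ℝ} (h : FastMul A a) : FastMul Aᵀ a := by
  induction h with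
  | sparse A E h =>
    simpa using sparse Aᵀ (E.map (Equiv.prodComm _ _).toEmbedding) fun i j hij => by
      simpa using h j i hij
  | mul A B a b _ _ hA hB =>
    rw [Matrix.transpose_mul, add_comm]
    exact mul _ _ _ _ hB hA
  | blockDiagonal A a _ ih =>
    rw [Matrix.blockDiagonal'_transpose]
    exact blockDiagonal _ _ ih
  | reindex A a e f _ ih =>
    rw [Matrix.transpose_submatrix]
    exact reindex _ _ _ _ ih
  | mono A a b hab _ ih => exact mono _ _ _ hab ih

/-- An entry costs a constant, a multiplication and an addition; the zero is needed as the value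
of empty sums. -/
theorem reach_mulVec {ι : Type} [Fintype n] {A : Matrix m n ℝ} (h : FastMul A a)
    {x : n → (ι → ℝ) → ℝ} {S : Set ((ι → ℝ) → ℝ)} (h0 : (fun _ => 0) ∈ S) (hx : ∀ j, x j ∈ S) :
    Reach S (Set.range fun i inp => (A *ᵥ fun j => x j inp) i) (3 * a) := by
  classical
  rename_i inst
  revert inst
  induction h generalizing S with
  | @sparse m n A E h =>
    intro _
    -- zero rows are sums over the empty set; only the rows meeting `E` contribute to the cost
    have hrow : ∀ i, (fun inp : ι → ℝ => (A *ᵥ fun j => x j inp) i) =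
        fun inp => ∑ e ∈ E with e.1 = i, A e.1 e.2 * x e.2 inp := by
      intro i
      funext inp
      simp only [Matrix.mulVec, dotProduct]
      symm
      refine Finset.sum_bij_ne_zero (fun e _ _ => e.2) (fun _ _ _ => Finset.mem_univ _) ?_ ?_ ?_
      · rintro ⟨a, b⟩ h1 _ ⟨a', b'⟩ h2 _ h3
        simp only [Finset.mem_filter] at h1 h2
        ext <;> grind
      · intro j _ hj
        exact ⟨(i, j), by simpa using h i j (left_ne_zero_of_mul hj), hj, rfl⟩
      · rintro ⟨a, b⟩ h1 _
        simp only [Finset.mem_filter] at h1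
        rw [h1.2]
    rw [funext hrow]
    have hsum : ∀ i, Reach S {fun inp => ∑ e ∈ E with e.1 = i, A e.1 e.2 * x e.2 inp}
        ((E.filter fun e => e.1 = i).card * 3) := fun i =>
      Reach.sum (c := 2) (F := fun (e : m × n) inp => A e.1 e.2 * x e.2 inp) _ h0 fun e _ =>
        ((Reach.const (A e.1 e.2)).keep.trans (Reach.mul (by simp) (by simp [hx])))
    have hz : Reach S {fun _ => 0} 0 := Reach.of_subset (by simpa using h0)
    refine ((Reach.biUnion (E.image Prod.fst) fun i _ => hsum i).union hz).mono subset_rfl ?_ ?_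
    · rintro _ ⟨i, rfl⟩
      by_cases hi : i ∈ E.image Prod.fst
      · exact Or.inl (Set.mem_biUnion hi rfl)
      · right
        have : (E.filter fun e => e.1 = i) = ∅ := by
          ext e
          simp only [Finset.mem_image, not_exists, not_and] at hi
          simpa using hi e
        simp [this]
    · rw [← Finset.sum_mul, ← Finset.card_eq_sum_card_image, add_zero, mul_comm]
  | mul A B a b _ _ ihA ihB =>
    intro _
    have hB := (ihB h0 hx).keep
    have hA := ihA (x := fun k inp => (B *ᵥ fun j => x j inp) k)
      (S := S ∪ Set.range fun i inp => (B *ᵥ fun j => x j inp) i) (Or.inl h0)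
      (fun j => Or.inr ⟨j, rfl⟩)
    refine (hB.trans hA).mono subset_rfl ?_ (by omega)
    simp_rw [← Matrix.mulVec_mulVec]
    exact subset_rfl
  | @blockDiagonal o _ _ m n A a _ ih =>
    intro inst
    obtain ⟨instn, rfl⟩ : ∃ _ : ∀ k, Fintype (n k), inst = Sigma.instFintype :=
      ⟨fun k => Fintype.ofInjective (fun j => (⟨k, j⟩ : Σ k, n k)) sigma_mk_injective,
        Subsingleton.elim _ _⟩
    have := Reach.biUnion Finset.univ fun k _ => ih k (x := fun j => x ⟨k, j⟩) h0 (fun j => hx _)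
    refine this.mono subset_rfl ?_ (by rw [Finset.mul_sum])
    rintro _ ⟨⟨k, i⟩, rfl⟩
    simp only [Finset.mem_univ, Set.iUnion_true, Set.mem_iUnion, Set.mem_range]
    refine ⟨k, i, ?_⟩
    funext inp
    simp only [Matrix.mulVec, dotProduct, Fintype.sum_sigma]
    rw [Finset.sum_eq_single k]
    · simp
    · intro k' _ hk
      simp [Matrix.blockDiagonal'_apply_ne _ _ _ hk.symm]
    · simp
  | reindex A a e f _ ih =>
    intro _
    let := Fintype.ofEquiv _ f
    refine (ih (x := fun j => x (f.symm j)) h0 fun j => hx _).mono subset_rfl ?_ le_rfl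
    rintro _ ⟨i, rfl⟩
    refine ⟨e i, ?_⟩
    funext inp
    simp only [Matrix.mulVec, dotProduct, Matrix.submatrix_apply]
    rw [← Equiv.sum_comp f]
    simp
  | mono A a b hab _ ih =>
    intro _
    exact (ih h0 hx).mono subset_rfl subset_rfl (by omega)

/-- A matrix whose nonzero entries are among the positions listed by `f`. -/
theorem of_support {E : Type} [Fintype E] {A : Matrix m n ℝ} (f : E → m × n)
    (h : ∀ i j, A i j ≠ 0 → ∃ e, f e = (i, j)) : FastMul A (Fintype.card E) := by
  classical
  refine mono _ _ _ Finset.card_image_le (sparse A (Finset.univ.image f) fun i j hij => ?_)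
  simpa using h i j hij

theorem diagonal [Fintype m] [DecidableEq m] (d : m → ℝ) :
    FastMul (Matrix.diagonal d) (Fintype.card m) :=
  of_support (fun i => (i, i)) fun i j hij => ⟨i, by
    rw [Prod.mk.injEq]
    exact ⟨rfl, by_contra fun h => hij (Matrix.diagonal_apply_ne _ h)⟩⟩

/-- Picking (and repeating) rows is multiplication by a matrix with one entry in each row. -/
theorem submatrix_rows [Fintype m] [Fintype p] {A : Matrix m n ℝ} (h : FastMul A a) (f : p → m) :
    FastMul (A.submatrix f id) (Fintype.card p + a) := by
  classical
  have h1 : FastMul ((1 : Matrix m m ℝ).submatrix f id) (Fintype.card p) :=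
    of_support (fun i => (i, f i)) fun i j hij => ⟨i, by
      rw [Prod.mk.injEq]
      exact ⟨rfl, by_contra fun h => hij (Matrix.one_apply_ne h)⟩⟩
  have h2 : A.submatrix f id = (1 : Matrix m m ℝ).submatrix f id * A := by
    ext i j
    simp [Matrix.mul_apply, Matrix.one_apply]
  rw [h2]
  exact mul _ _ _ _ h1 h

theorem submatrix_cols [Fintype n] [Fintype q] {A : Matrix m n ℝ} (h : FastMul A a) (g : q → n) :
    FastMul (A.submatrix id g) (Fintype.card q + a) := by
  simpa using (h.transpose.submatrix_rows g).transpose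

theorem blockDiagonal_const {o : Type} [Fintype o] [DecidableEq o] {A : o → Matrix m n ℝ}
    (h : ∀ k, FastMul (A k) a) :
    FastMul (Matrix.blockDiagonal A) (Fintype.card o * a) := by
  rw [← Matrix.blockDiagonal'_submatrix_eq_blockDiagonal]
  refine mono _ (∑ _ : o, a) _ (by simp) (reindex (Matrix.blockDiagonal' A) _
    ((Equiv.prodComm _ _).trans (Equiv.sigmaEquivProd o m).symm)
    ((Equiv.prodComm _ _).trans (Equiv.sigmaEquivProd o n).symm) (blockDiagonal A _ h))

open scoped Kronecker in
theorem kronecker [Fintype n] [Fintype p] {A : Matrix m n ℝ} {B : Matrix p q ℝ}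
    (hA : FastMul A a) (hB : FastMul B b) :
    FastMul (A ⊗ₖ B) (Fintype.card p * a + Fintype.card n * b) := by
  classical
  have h : A ⊗ₖ B = (A ⊗ₖ (1 : Matrix p p ℝ)) * ((1 : Matrix n n ℝ) ⊗ₖ B) := by
    rw [← Matrix.mul_kronecker_mul, Matrix.mul_one, Matrix.one_mul]
  rw [h]
  refine mul _ _ _ _ ?_ ?_
  · rw [Matrix.kronecker_one]
    exact blockDiagonal_const (o := p) fun _ => hA
  · rw [Matrix.one_kronecker, Matrix.reindex_apply]
    exact reindex _ _ _ _ (blockDiagonal_const (o := n) fun _ => hB)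

end FastMul

/-- The tensor power of a matrix. -/
def tensorPow (A : Matrix m n ℝ) (j : ℕ) : Matrix (Fin j → m) (Fin j → n) ℝ :=
  fun a b => ∏ t, A (a t) (b t)

/-- The dimension-by-dimension evaluation of a tensor power. -/
theorem FastMul.tensorPow {m : Type} [Fintype m] {A : Matrix m m ℝ} {c : ℕ} (hc : 1 ≤ c)
    (h : FastMul A (Fintype.card m * c)) (j : ℕ) :
    FastMul (tensorPow A j) ((j + 1) * Fintype.card m ^ j * c) := by
  induction j with
  | zero =>
    refine mono _ 1 _ (by simpa using hc) ?_
    simpa using of_support (A := AnovaLSQR.tensorPow A 0) (E := Unit)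
      (fun _ => (Fin.elim0, Fin.elim0))
      fun i j _ => ⟨(), by rw [Prod.mk.injEq]; exact ⟨Subsingleton.elim _ _, Subsingleton.elim _ _⟩⟩
  | succ j ih =>
    have h1 := (h.kronecker ih).reindex _ _ (Fin.consEquiv fun _ : Fin (j + 1) => m).symm
      (Fin.consEquiv fun _ : Fin (j + 1) => m).symm
    convert h1 using 1
    · ext a b
      simp [AnovaLSQR.tensorPow, Fin.prod_univ_succ, Fin.consEquiv, Matrix.kroneckerMap_apply,
        Fin.tail]
    · simp
      ring

/-! ### The cost of an iteration of LSQR -/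

section Step

variable {ι m n : Type} [Fintype m] [Fintype n] {S : Set ((ι → ℝ) → ℝ)}

theorem Reach.normalize {p : m → (ι → ℝ) → ℝ} (h0 : (fun _ => 0) ∈ S) (hp : ∀ i, p i ∈ S) :
    Reach S ({fun inp => AnovaLSQR.norm2 fun i => p i inp} ∪
      Set.range fun i inp => p i inp / AnovaLSQR.norm2 fun i => p i inp)
      (3 * Fintype.card m + 1) := by
  have h1 : Reach S _ _ := Reach.norm2 h0 hp
  have h2 : Reach (S ∪ {fun inp => AnovaLSQR.norm2 fun i => p i inp}) _ _ :=
    Reach.range fun i => Reach.div (Or.inl (hp i)) (Or.inr rfl)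
  refine (h1.keep.andThen h2).mono subset_rfl ?_ (by omega)
  exact Set.union_subset_union_left _ Set.subset_union_right

/-- One half of a bidiagonalization step: a product with the matrix, the subtraction of a
multiple of the previous vector, and a normalization. -/
theorem Reach.bidiagonalize {A : Matrix m n ℝ} {a : ℕ} (hA : FastMul A a)
    {x : n → (ι → ℝ) → ℝ} {y : m → (ι → ℝ) → ℝ} {r : (ι → ℝ) → ℝ} (h0 : (fun _ => 0) ∈ S)
    (hx : ∀ j, x j ∈ S) (hy : ∀ i, y i ∈ S) (hr : r ∈ S) {p : m → (ι → ℝ) → ℝ}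
    (hp : p = fun i inp => (A *ᵥ fun j => x j inp) i - r inp * y i inp) :
    Reach S ({fun inp => AnovaLSQR.norm2 fun i => p i inp} ∪
      Set.range fun i inp => p i inp / AnovaLSQR.norm2 fun i => p i inp)
      (3 * a + 5 * Fintype.card m + 1) := by
  have h1 := hA.reach_mulVec h0 hx
  have h2 : Reach S (Set.range fun i inp => r inp * y i inp) _ :=
    Reach.range fun i => Reach.mul hr (hy i)
  have h3 : Reach (S ∪ ((Set.range fun i inp => (A *ᵥ fun j => x j inp) i) ∪
      Set.range fun i inp => r inp * y i inp)) (Set.range p) (Fintype.card m * 1) := by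
      rw [hp]
      exact Reach.range fun i => Reach.sub (f := fun inp => (A *ᵥ fun j => x j inp) i)
        (g := fun inp => r inp * y i inp) (Or.inr (Or.inl ⟨i, rfl⟩)) (Or.inr (Or.inr ⟨i, rfl⟩))
  have h4 : Reach (S ∪ Set.range p) _ _ :=
    Reach.normalize (Or.inl h0) fun i => Or.inr ⟨i, rfl⟩
  refine (((h1.union h2).keep.trans h3).keep.trans h4).mono subset_rfl subset_rfl (by omega)

theorem Reach.add_mul_range {x y : n → (ι → ℝ) → ℝ} {r : (ι → ℝ) → ℝ}
    (hx : ∀ j, x j ∈ S) (hy : ∀ j, y j ∈ S) (hr : r ∈ S) :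
    Reach S (Set.range fun j inp => x j inp + r inp * y j inp) (2 * Fintype.card n) := by
  refine (Reach.range (c := 1 + 1) fun j =>
    (Reach.mul hr (hy j)).keep.trans (Reach.add (Or.inl (hx j)) (Or.inr rfl))).mono
    subset_rfl subset_rfl (by omega)

theorem Reach.sub_mul_range {x y : n → (ι → ℝ) → ℝ} {r : (ι → ℝ) → ℝ}
    (hx : ∀ j, x j ∈ S) (hy : ∀ j, y j ∈ S) (hr : r ∈ S) :
    Reach S (Set.range fun j inp => x j inp - r inp * y j inp) (2 * Fintype.card n) := by
  refine (Reach.range (c := 1 + 1) fun j =>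
    (Reach.mul hr (hy j)).keep.trans (Reach.sub (Or.inl (hx j)) (Or.inr rfl))).mono
    subset_rfl subset_rfl (by omega)

/-- The scalars of the plane rotation and of the updates that follow it. -/
theorem Reach.rotation {β α r φ : (ι → ℝ) → ℝ} (h0 : (fun _ => 0) ∈ S) (hβ : β ∈ S) (hα : α ∈ S)
    (hr : r ∈ S) (hφ : φ ∈ S) {ρ c s : (ι → ℝ) → ℝ}
    (hρ : ρ = fun inp => √(r inp ^ 2 + β inp ^ 2)) (hc : c = fun inp => r inp / ρ inp)
    (hs : s = fun inp => β inp / ρ inp) :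
    Reach S {fun inp => s inp * α inp / ρ inp, fun inp => c inp * φ inp / ρ inp,
      fun inp => -c inp * α inp, fun inp => s inp * φ inp} 13 := by
  have h1 : Reach S {ρ} 4 := by
    rw [hρ]
    exact (((Reach.sq hr).union (Reach.sq hβ)).trans (Reach.add
      (f := fun inp => r inp ^ 2) (g := fun inp => β inp ^ 2) (by simp) (by simp))).trans
      (Reach.sqrt rfl)
  have h2 : Reach (S ∪ {ρ}) ({c} ∪ {s}) 2 := by
    rw [hc, hs]
    exact (Reach.div (Or.inl hr) (Or.inr rfl)).union (Reach.div (Or.inl hβ) (Or.inr rfl))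
  have h3 : Reach S (S ∪ {ρ} ∪ ({c} ∪ {s})) 6 := h1.keep.andThen h2
  set T := S ∪ {ρ} ∪ ({c} ∪ {s})
  have hST : S ⊆ T := fun f hf => Or.inl (Or.inl hf)
  have kρ : ρ ∈ T := Or.inl (Or.inr rfl)
  have kc : c ∈ T := Or.inr (Or.inl rfl)
  have ks : s ∈ T := Or.inr (Or.inr rfl)
  have h4 : Reach T {fun inp => s inp * α inp / ρ inp} (1 + 1) :=
    (Reach.mul ks (hST hα)).keep.trans (Reach.div (Or.inr rfl) (Or.inl kρ))
  have h5 : Reach T {fun inp => c inp * φ inp / ρ inp} (1 + 1) :=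
    (Reach.mul kc (hST hφ)).keep.trans (Reach.div (Or.inr rfl) (Or.inl kρ))
  have h6 : Reach T {fun inp => -c inp * α inp} (1 + 1) := by
    have := (Reach.sub (hST h0) kc).keep.trans (Reach.mul (Or.inr rfl) (Or.inl (hST hα)))
    simpa using this
  have h7 : Reach T {fun inp => s inp * φ inp} 1 := Reach.mul ks (hST hφ)
  refine (h3.trans (h4.union (h5.union (h6.union h7)))).mono subset_rfl ?_ le_rfl
  simp only [Set.singleton_union]
  exact subset_rfl

/-- The state with prescribed contents of its cells. -/
def LSQRState.ofCells (inp : LSQRCell m n → ℝ) : LSQRState m n where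
  u i := inp (.u i)
  v k := inp (.v k)
  w k := inp (.w k)
  h k := inp (.h k)
  alpha := inp .alpha
  rhoBar := inp .rhoBar
  phiBar := inp .phiBar

/-- An iteration of LSQR applies the matrix and its transpose once each; the rest is linear in
the size of the state. -/
theorem exists_program_lsqr {A : Matrix m n ℝ} {a : ℕ} (hA : FastMul A a) :
    ∃ P : Program (LSQRCell m n) (LSQRCell m n),
      P.cost ≤ 6 * a + 5 * Fintype.card m + 9 * Fintype.card n + 16 ∧
      ∀ b : m → ℝ, P.PerformsLSQR A b := by
  let V := (LSQRCell m n → ℝ) → ℝ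
  let S₀ : Set V := (Set.range fun i inp => inp i) ∪ {fun _ => 0}
  let p : m → V := fun i inp => (A *ᵥ fun j => inp (.v j)) i - inp .alpha * inp (.u i)
  let β : V := fun inp => norm2 fun i => p i inp
  let u : m → V := fun i inp => p i inp / β inp
  let q : n → V := fun k inp => (Aᵀ *ᵥ fun i => u i inp) k - β inp * inp (.v k)
  let α : V := fun inp => norm2 fun k => q k inp
  let v : n → V := fun k inp => q k inp / α inp
  let ρ : V := fun inp => √(inp .rhoBar ^ 2 + β inp ^ 2)
  let c : V := fun inp => inp .rhoBar / ρ inp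
  let s : V := fun inp => β inp / ρ inp
  have hin : ∀ i, (fun inp => inp i) ∈ S₀ := fun i => Or.inl ⟨i, rfl⟩
  have hz : (fun _ => 0) ∈ S₀ := Or.inr rfl
  have h1 : Reach (Set.range fun i inp => inp i) S₀ 1 := (Reach.const 0).keep
  have h2 : Reach S₀ ({β} ∪ Set.range u) (3 * a + 5 * Fintype.card m + 1) :=
    Reach.bidiagonalize hA hz (fun j => hin (.v j)) (fun i => hin (.u i)) (hin .alpha)
      (p := p) rfl
  have h12 := h1.trans h2.keep
  set S₁ := S₀ ∪ ({β} ∪ Set.range u)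
  have s01 : S₀ ⊆ S₁ := Set.subset_union_left
  have kβ : β ∈ S₁ := Or.inr (Or.inl rfl)
  have ku : ∀ i, u i ∈ S₁ := fun i => Or.inr (Or.inr ⟨i, rfl⟩)
  have h3 : Reach S₁ ({α} ∪ Set.range v) (3 * a + 5 * Fintype.card n + 1) :=
    Reach.bidiagonalize hA.transpose (s01 hz) ku (fun k => s01 (hin (.v k))) kβ (p := q) rfl
  have h123 := h12.trans h3.keep
  set S₂ := S₁ ∪ ({α} ∪ Set.range v)
  have s12 : S₁ ⊆ S₂ := Set.subset_union_left
  have kα : α ∈ S₂ := Or.inr (Or.inl rfl)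
  have kv : ∀ k, v k ∈ S₂ := fun k => Or.inr (Or.inr ⟨k, rfl⟩)
  have h4 : Reach S₂ _ 13 := Reach.rotation (s12 (s01 hz)) (s12 kβ) kα
    (s12 (s01 (hin .rhoBar))) (s12 (s01 (hin .phiBar))) (ρ := ρ) (c := c) (s := s) rfl rfl rfl
  have h1234 := h123.trans h4.keep
  set R : Set V := {fun inp => s inp * α inp / ρ inp, fun inp => c inp * inp .phiBar / ρ inp,
      fun inp => -c inp * α inp, fun inp => s inp * inp .phiBar}
  have s23 : S₂ ⊆ S₂ ∪ R := Set.subset_union_left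
  have h5 : Reach (S₂ ∪ R)
      (Set.range fun k inp => v k inp - s inp * α inp / ρ inp * inp (.w k)) _ :=
    Reach.sub_mul_range (fun k => s23 (kv k)) (fun k => s23 (s12 (s01 (hin (.w k)))))
      (Or.inr (Or.inl rfl))
  have h6 : Reach (S₂ ∪ R)
      (Set.range fun k inp => inp (.h k) + c inp * inp .phiBar / ρ inp * inp (.w k)) _ :=
    Reach.add_mul_range (fun k => s23 (s12 (s01 (hin (.h k)))))
      (fun k => s23 (s12 (s01 (hin (.w k))))) (Or.inr (Or.inr (Or.inl rfl)))
  have h7 := (h1234.trans (h5.union h6).keep)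
  let F : LSQRCell m n → V := fun o inp => (lsqrStep A (LSQRState.ofCells inp)).read o
  have hF : Set.range F ⊆ S₂ ∪ R ∪
      ((Set.range fun k inp => v k inp - s inp * α inp / ρ inp * inp (.w k)) ∪
        Set.range fun k inp => inp (.h k) + c inp * inp .phiBar / ρ inp * inp (.w k)) := by
    rintro _ ⟨o, rfl⟩
    cases o with
    | u i => exact Or.inl (s23 (s12 (ku i)))
    | v k => exact Or.inl (s23 (kv k))
    | w k => exact Or.inr (Or.inl ⟨k, rfl⟩)
    | h k => exact Or.inr (Or.inr ⟨k, rfl⟩)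
    | alpha => exact Or.inl (s23 kα)
    | rhoBar => exact Or.inl (Or.inr (Or.inr (Or.inr (Or.inl rfl))))
    | phiBar => exact Or.inl (Or.inr (Or.inr (Or.inr (Or.inr rfl))))
  obtain ⟨P, hP, hPe⟩ := Reach.exists_program (h7.mono subset_rfl hF le_rfl)
  refine ⟨P, by omega, fun b t => ?_⟩
  rw [hPe]
  rfl

end Step

/-! ### The fast cosine transform -/

/-- The matrix of the normed Chebyshev polynomials `√2 T_k`, `k < n`, at the points with angles
`(a + 2πl) / n`, `l < n`. -/
def cosMatrix (n : ℕ) (a : ℝ) : Matrix (Fin n) (Fin n) ℝ :=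
  fun l k => √2 * Real.cos (k * ((a + 2 * Real.pi * l) / n))

/-- Reduction of a Chebyshev expansion of degree less than `2 * n` modulo `T_n - c b`, for
`b = 0, 1`: the term `T_(n+j)` is replaced by `2 * c b * T_j - T_(n-j)`, and `T_n` by `c b`. -/
def chebReduction (n : ℕ) (c : Fin 2 → ℝ) : Matrix (Fin n × Fin 2) (Fin (n * 2)) ℝ :=
  fun j k =>
    if (k : ℕ) < n then if (j.1 : ℕ) = k then 1 else 0
    else (if (j.1 : ℕ) = k - n then if (j.1 : ℕ) = 0 then c j.2 else 2 * c j.2 else 0) -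
      if (j.1 : ℕ) = 2 * n - k then 1 else 0

theorem fastMul_chebReduction (n : ℕ) (c : Fin 2 → ℝ) : FastMul (chebReduction n c) (6 * n) := by
  let κ : (Fin n × Fin 2) × Fin 3 → ℕ := fun e =>
    ![(e.1.1 : ℕ), e.1.1 + n, 2 * n - e.1.1] e.2
  have h := FastMul.of_support (A := chebReduction n c)
    (fun e : (Fin n × Fin 2) × Fin 3 =>
      (e.1, if h : κ e < n * 2 then ⟨κ e, h⟩ else ⟨e.1.1, by omega⟩)) ?_
  · refine FastMul.mono _ _ _ (le_of_eq ?_) h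
    simp
    ring
  · rintro ⟨j, b⟩ k hk
    have hk2 := k.2
    have key : ∃ t : Fin 3, κ ((j, b), t) = k := by
      by_contra! hne
      have h0 := hne 0
      have h1 := hne 1
      have h2 := hne 2
      simp only [κ, Matrix.cons_val] at h0 h1 h2
      have h1' : ¬(j : ℕ) = k - n ∨ (k : ℕ) < n := by omega
      have h2' : ¬(j : ℕ) = 2 * n - k := by omega
      apply hk
      unfold chebReduction
      by_cases hkn : (k : ℕ) < n
      · rw [if_pos hkn, if_neg h0]
      · rw [if_neg hkn, if_neg (h1'.resolve_right hkn), if_neg h2', sub_zero]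
    obtain ⟨t, ht⟩ := key
    refine ⟨((j, b), t), ?_⟩
    rw [Prod.mk.injEq]
    refine ⟨rfl, ?_⟩
    rw [dif_pos (by omega)]
    exact Fin.ext ht

theorem sum_fin_eq_ite (n i : ℕ) (f : ℕ → ℝ) :
    ∑ j : Fin n, f j * (if (j : ℕ) = i then 1 else 0) = if i < n then f i else 0 := by
  rw [Fin.sum_univ_eq_sum_range (fun j => f j * if j = i then 1 else 0)]
  simp

/-- The Chebyshev recurrence `cos ((n + j) φ) = 2 cos (n φ) cos (j φ) - cos ((n - j) φ)`. -/
theorem sum_cos_mul_chebReduction (n : ℕ) (φ : ℝ) (c : Fin 2 → ℝ) (b : Fin 2)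
    (hc : Real.cos (n * φ) = c b) (k : Fin (n * 2)) :
    ∑ j : Fin n, √2 * Real.cos (j * φ) * chebReduction n c (j, b) k =
      √2 * Real.cos (k * φ) := by
  have hk := k.2
  set f : ℕ → ℝ := fun j => √2 * Real.cos (j * φ) with hf
  change ∑ j : Fin n, f j * chebReduction n c (j, b) k = f k
  unfold chebReduction
  by_cases hkn : (k : ℕ) < n
  · simp only [hkn, if_true]
    rw [sum_fin_eq_ite, if_pos hkn]
  · simp only [hkn, if_false]
    have h1 : ∀ j : Fin n, f j * ((if (j : ℕ) = k - n then if (j : ℕ) = 0 then c b else 2 * c b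
        else 0) - if (j : ℕ) = 2 * n - k then 1 else 0) =
        (f j * if (j : ℕ) = 0 then c b else 2 * c b) * (if (j : ℕ) = k - n then 1 else 0) -
          f j * (if (j : ℕ) = 2 * n - k then 1 else 0) := by
      intro j
      by_cases h : (j : ℕ) = k - n <;> simp [h, mul_sub]
    rw [Finset.sum_congr rfl fun j _ => h1 j, Finset.sum_sub_distrib, sum_fin_eq_ite,
      sum_fin_eq_ite n _ fun j => f j * if j = 0 then c b else 2 * c b, if_pos (by omega)]
    rcases Nat.eq_or_lt_of_le (not_lt.1 hkn) with h | h
    · simp only [← h, Nat.sub_self, if_true, hf, hc]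
      rw [if_neg (by omega)]
      simp
    · rw [if_neg (by omega), if_pos (by omega)]
      obtain ⟨j, hj⟩ := Nat.exists_eq_add_of_lt h
      have h2 : 2 * n - (k : ℕ) = n - (j + 1) := by omega
      have h3 : (k : ℕ) - n = j + 1 := by omega
      have h4 : (k : ℕ) = n + (j + 1) := by omega
      rw [h2, h3]
      simp only [hf, h4, ← hc, Nat.cast_sub (show j + 1 ≤ n by omega), Nat.cast_add n (j + 1)]
      rw [add_mul, sub_mul, Real.cos_add, Real.cos_sub]
      ring

/-- The step from `n` to `2 * n`: at the angles `(a + 2πl) / (2n)` the polynomial `T_n` takes the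
value `cos (a / 2)` for even `l` and `cos (a / 2 + π)` for odd `l`. -/
theorem cosMatrix_two_mul {n : ℕ} (a : ℝ) :
    cosMatrix (n * 2) a =
      (Matrix.blockDiagonal (fun b : Fin 2 => cosMatrix n (a / 2 + b * Real.pi)) *
        chebReduction n fun b => Real.cos (a / 2 + b * Real.pi)).submatrix
          finProdFinEquiv.symm (Equiv.refl _) := by
  ext l k
  obtain ⟨⟨l, b⟩, rfl⟩ := finProdFinEquiv.surjective l
  have hn : (n : ℝ) ≠ 0 := by
    have := l.pos
    positivity
  simp only [Matrix.submatrix_apply, Equiv.symm_apply_apply, Equiv.refl_apply, Matrix.mul_apply,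
    Fintype.sum_prod_type, Matrix.blockDiagonal_apply, ite_mul, zero_mul, Finset.sum_ite_eq,
    Finset.mem_univ, if_true]
  rw [cosMatrix]
  have hφ : (a + 2 * Real.pi * ((finProdFinEquiv (l, b) : Fin (n * 2)) : ℕ)) / (n * 2 : ℕ) =
      (a / 2 + b * Real.pi + 2 * Real.pi * l) / n := by
    simp
    field_simp
    ring
  rw [hφ]
  symm
  apply sum_cos_mul_chebReduction
  rw [mul_div_cancel₀ _ hn]
  have := Real.cos_add_nat_mul_two_pi (a / 2 + b * Real.pi) l
  rw [← this]
  ring_nf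

theorem fastMul_cosMatrix (r : ℕ) (a : ℝ) :
    FastMul (cosMatrix (2 ^ r) a) (2 ^ r * (3 * (r + 1))) := by
  induction r generalizing a with
  | zero =>
    refine FastMul.mono _ 1 _ (by simp) ?_
    have := FastMul.of_support (A := cosMatrix (2 ^ 0) a) (E := Unit) (fun _ => (0, 0)) fun i j _ =>
      ⟨(), Prod.ext (Fin.fin_one_eq_zero i).symm (Fin.fin_one_eq_zero j).symm⟩
    rwa [Fintype.card_unit] at this
  | succ r ih =>
    rw [pow_succ, cosMatrix_two_mul]
    refine FastMul.mono _ _ _ (le_of_eq ?_) ((FastMul.mul _ _ _ _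
      (FastMul.blockDiagonal_const fun b => ih _) (fastMul_chebReduction _ _)).reindex _ _ _ _)
    simp
    ring

/-! ### Index sets -/

section Index

variable {d ds : ℕ} {N : ℕ → ℕ}

/-- The support of a frequency. -/
def freqSupport (k : Fin d → ℕ) : Finset (Fin d) :=
  Finset.univ.filter fun s => k s ≠ 0

theorem mem_orderIndex {k : Fin d → ℕ} (hk : k ∈ orderIndex d ds N) :
    freqSupport k ∈ termsUpTo d ds ∧
      ∀ s ∈ freqSupport k, k s < (Finset.Icc 1 ds).sup N := by
  simp only [orderIndex, groupedIndex, Finset.mem_biUnion] at hk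
  obtain ⟨u, hu, hk⟩ := hk
  simp only [termIndex, Fintype.mem_piFinset] at hk
  have hsupp : freqSupport k = u := by
    ext s
    have hs := hk s
    by_cases h : s ∈ u <;> simp [h, freqSupport] at hs ⊢ <;> omega
  rw [hsupp]
  refine ⟨hu, fun s hs => ?_⟩
  have h1 := hk s
  rw [if_pos hs, Finset.mem_Icc] at h1
  have hcard : u.card ∈ Finset.Icc 1 ds := by
    rw [Finset.mem_Icc]
    exact ⟨Finset.card_pos.2 ⟨s, hs⟩, (Finset.mem_filter.1 hu).2⟩
  have := Finset.le_sup (f := N) hcard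
  omega

/-- A set of at most `ds` coordinates is the set of values of a map from `Fin ds`, one extra
value being allowed for padding. -/
theorem card_termsUpTo_le (d ds : ℕ) : (termsUpTo d ds).card ≤ (d + 1) ^ ds := by
  classical
  have h : termsUpTo d ds ⊆ Finset.univ.image fun F : Fin ds → Option (Fin d) =>
      Finset.univ.filter fun s => ∃ t, F t = some s := by
    intro u hu
    have hu : u.card ≤ ds := (Finset.mem_filter.1 hu).2
    simp only [Finset.mem_image, Finset.mem_univ, true_and]
    refine ⟨fun t => if h : (t : ℕ) < u.card then some (u.equivFin.symm ⟨t, h⟩) else none, ?_⟩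
    ext s
    simp only [Finset.mem_filter, Finset.mem_univ, true_and]
    constructor
    · rintro ⟨t, ht⟩
      split_ifs at ht with h
      rw [← Option.some.inj ht]
      exact Subtype.prop _
    · intro hs
      refine ⟨⟨u.equivFin ⟨s, hs⟩, by omega⟩, ?_⟩
      simp
  refine (Finset.card_le_card h).trans (Finset.card_image_le.trans ?_)
  simp

theorem card_orderIndex_le {Nmax : ℕ} (hN : Nmax = (Finset.Icc 1 ds).sup N) (h1 : 1 ≤ Nmax) :
    (orderIndex d ds N).card ≤ (termsUpTo d ds).card * Nmax ^ ds := by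
  refine Finset.card_biUnion_le_card_mul _ _ _ fun u hu => ?_
  have hu : u.card ≤ ds := (Finset.mem_filter.1 hu).2
  rw [termIndex, Fintype.card_piFinset]
  have h2 : ∀ s ∈ Finset.univ, (if s ∈ u then Finset.Icc 1 (N u.card - 1) else {0}).card ≤
      if s ∈ u then Nmax else 1 := by
    intro s _
    split_ifs with hs
    · have := Finset.le_sup (f := N) (Finset.mem_Icc.2
        ⟨show 1 ≤ u.card from Finset.card_pos.2 ⟨s, hs⟩, hu⟩)
      simp only [Nat.card_Icc]
      omega
    · simp
  refine (Finset.prod_le_prod' h2).trans ?_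
  rw [Finset.prod_ite_mem, Finset.univ_inter, Finset.prod_const]
  exact Nat.pow_le_pow_right h1 hu

end Index

/-! ### Rounding the nodes to a grid -/

theorem exists_grid_angle {n : ℕ} (hn : 0 < n) {φ : ℝ} (h0 : 0 ≤ φ) (h1 : φ ≤ Real.pi) :
    ∃ l : Fin n, |(0 + 2 * Real.pi * l) / n - φ| ≤ 2 * Real.pi / n := by
  have hπ := Real.pi_pos
  have hn' : (0 : ℝ) < n := by exact_mod_cast hn
  have ht : 0 ≤ φ * n / (2 * Real.pi) := by positivity
  have hle := Nat.floor_le ht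
  have hlt := Nat.lt_floor_add_one (φ * n / (2 * Real.pi))
  have hbound : ⌊φ * n / (2 * Real.pi)⌋₊ < n := by
    rw [Nat.floor_lt ht, div_lt_iff₀ (by positivity)]
    nlinarith
  refine ⟨⟨_, hbound⟩, ?_⟩
  generalize ⌊φ * n / (2 * Real.pi)⌋₊ = m at *
  rw [le_div_iff₀ (by positivity)] at hle
  rw [div_lt_iff₀ (by positivity)] at hlt
  rw [abs_le]
  constructor
  · rw [← sub_nonneg]
    have : (0 + 2 * Real.pi * m) / n - φ - -(2 * Real.pi / n) =
        ((m + 1) * (2 * Real.pi) - φ * n) / n := by field_simp; ring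
    rw [this]
    exact div_nonneg (by linarith) hn'.le
  · have : (0 + 2 * Real.pi * m) / n - φ = (m * (2 * Real.pi) - φ * n) / n := by field_simp; ring
    rw [this]
    exact div_le_div_of_nonneg_right (by linarith) hn'.le

theorem abs_prod_sub_prod_le {κ : Type*} (u : Finset κ) {f g : κ → ℝ} (hf : ∀ s, |f s| ≤ 1)
    (hg : ∀ s, |g s| ≤ 1) : |∏ s ∈ u, f s - ∏ s ∈ u, g s| ≤ ∑ s ∈ u, |f s - g s| := by
  classical
  induction u using Finset.induction_on with
  | empty => simp
  | insert a u ha ih =>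
    rw [Finset.prod_insert ha, Finset.prod_insert ha, Finset.sum_insert ha]
    have h1 : |∏ s ∈ u, f s| ≤ 1 := by
      rw [Finset.abs_prod]
      exact Finset.prod_le_one (fun _ _ => abs_nonneg _) fun s _ => hf s
    calc |f a * ∏ s ∈ u, f s - g a * ∏ s ∈ u, g s|
        = |(f a - g a) * ∏ s ∈ u, f s + g a * (∏ s ∈ u, f s - ∏ s ∈ u, g s)| := by ring_nf
      _ ≤ |f a - g a| * |∏ s ∈ u, f s| + |g a| * |∏ s ∈ u, f s - ∏ s ∈ u, g s| := by
        rw [← abs_mul, ← abs_mul]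
        exact abs_add_le _ _
      _ ≤ |f a - g a| * 1 + 1 * ∑ s ∈ u, |f s - g s| := by
        gcongr
        exact hg a
      _ = _ := by ring

/-- The Chebyshev system at nodes whose angles are rounded to multiples of `2π/n`: it is close to
the original system, and all its ANOVA terms come from one fast transform each, followed by a
selection of rows. -/
theorem exists_fastMul_near_systemMatrix {d ds M r : ℕ} {N : ℕ → ℕ} {Nmax : ℕ}
    (hNmax : Nmax = (Finset.Icc 1 ds).sup N) (hr : Nmax ≤ 2 ^ r) (x : Fin M → Fin d → ℝ) :
    ∃ G : Matrix (Fin M) (orderIndex d ds N) ℝ,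
      (∀ i k, |G i k - systemMatrix x (orderIndex d ds N) i k| ≤
        √2 ^ ds * (ds * (Nmax * (2 * Real.pi / (2 ^ r : ℕ))))) ∧
      FastMul G (M * (termsUpTo d ds).card + ((orderIndex d ds N).card +
        (M * (termsUpTo d ds).card +
          (termsUpTo d ds).card * ((ds + 1) * (2 ^ r) ^ ds * (3 * (r + 1)))))) := by
  classical
  set n := 2 ^ r with hn
  have hn0 : 0 < n := by positivity
  have : NeZero n := ⟨hn0.ne'⟩
  choose l hl using fun i s =>
    exists_grid_angle hn0 (Real.arccos_nonneg (x i s)) (Real.arccos_le_pi (x i s))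
  let o := {u // u ∈ termsUpTo d ds}
  let B := Matrix.blockDiagonal' fun u : o => tensorPow (cosMatrix n 0) u.1.card
  let f : Fin M × o → Σ u : o, Fin u.1.card → Fin n := fun p =>
    ⟨p.2, fun t => l p.1 (p.2.1.equivFin.symm t)⟩
  let g : orderIndex d ds N → Σ u : o, Fin u.1.card → Fin n := fun k =>
    ⟨⟨freqSupport k.1, (mem_orderIndex k.2).1⟩,
      fun t => Fin.ofNat n (k.1 ((freqSupport k.1).equivFin.symm t))⟩
  let R : Matrix (Fin M) (Fin M × o) ℝ := fun i p => if i = p.1 then 1 else 0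
  have hentry : ∀ i k, (R * (B.submatrix f id).submatrix id g) i k =
      √2 ^ (freqSupport k.1).card * ∏ s ∈ freqSupport k.1,
        Real.cos (k.1 s * ((0 + 2 * Real.pi * l i s) / n)) := by
    intro i k
    have h1 : (R * (B.submatrix f id).submatrix id g) i k = ∑ u, B (f (i, u)) (g k) := by
      rw [Matrix.mul_apply, Fintype.sum_prod_type]
      simp [R]
    rw [h1, Finset.sum_eq_single ⟨freqSupport k.1, (mem_orderIndex k.2).1⟩]
    · simp only [B, f, g, Matrix.blockDiagonal'_apply_eq, tensorPow, cosMatrix]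
      rw [Equiv.prod_comp (freqSupport k.1).equivFin.symm fun s =>
        √2 * Real.cos ((Fin.ofNat n (k.1 s) : Fin n) * ((0 + 2 * Real.pi * l i s) / n)),
        Finset.prod_coe_sort (freqSupport k.1) fun s =>
        √2 * Real.cos ((Fin.ofNat n (k.1 s) : Fin n) * ((0 + 2 * Real.pi * l i s) / n)),
        Finset.prod_mul_distrib, Finset.prod_const]
      congr 1
      refine Finset.prod_congr rfl fun s hs => ?_
      have hks := (mem_orderIndex k.2).2 s hs
      rw [Fin.val_ofNat, Nat.mod_eq_of_lt (by omega)]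
    · intro u _ hu
      exact Matrix.blockDiagonal'_apply_ne _ _ _ hu
    · simp
  refine ⟨R * (B.submatrix f id).submatrix id g, fun i k => ?_, ?_⟩
  · have hcard : (freqSupport k.1).card ≤ ds := (Finset.mem_filter.1 (mem_orderIndex k.2).1).2
    rw [hentry]
    change |_ - √2 ^ (freqSupport k.1).card * ∏ s ∈ freqSupport k.1,
      Real.cos (k.1 s * Real.arccos (x i s))| ≤ _
    rw [← mul_sub, abs_mul, abs_of_nonneg (by positivity)]
    refine mul_le_mul (pow_le_pow_right₀ (Real.one_le_sqrt.2 one_le_two) hcard) ?_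
      (abs_nonneg _) (by positivity)
    refine (abs_prod_sub_prod_le _ (fun s => Real.abs_cos_le_one _)
      fun s => Real.abs_cos_le_one _).trans ?_
    refine (Finset.sum_le_card_nsmul _ _ (Nmax * (2 * Real.pi / n)) fun s hs => ?_).trans ?_
    · refine (Real.abs_cos_sub_cos_le _ _).trans ?_
      rw [← mul_sub, abs_mul, Nat.abs_cast]
      have hks := (mem_orderIndex k.2).2 s hs
      exact mul_le_mul (by exact_mod_cast (by omega)) (hl i s) (abs_nonneg _) (by positivity)
    · rw [nsmul_eq_mul]
      gcongr
  · have hR : FastMul R (M * (termsUpTo d ds).card) := by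
      have := FastMul.of_support (A := R) (fun p => (p.1, p)) fun i p hp => ⟨p, by
        rw [Prod.mk.injEq]
        exact ⟨by_contra fun h => hp (if_neg fun h' => h h'.symm), rfl⟩⟩
      simpa [o] using this
    have hB : FastMul B
        ((termsUpTo d ds).card * ((ds + 1) * n ^ ds * (3 * (r + 1)))) := by
      have h := FastMul.blockDiagonal (fun u : o => tensorPow (cosMatrix n 0) u.1.card)
        (fun _ => (ds + 1) * n ^ ds * (3 * (r + 1))) fun u => by
          have hu : u.1.card ≤ ds := (Finset.mem_filter.1 u.2).2
          refine FastMul.mono _ _ _ ?_ (FastMul.tensorPow (c := 3 * (r + 1)) (by omega)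
            (by simpa using fastMul_cosMatrix r 0) _)
          rw [Fintype.card_fin]
          gcongr
      simpa [o] using h
    have h := FastMul.mul _ _ _ _ hR ((hB.submatrix_rows f).submatrix_cols g)
    simpa [o] using h

/-! ### The complexity bound -/

/-- The grid size: a power of two between `K * n` and `2 * K * n`. The term `M` absorbs the case
`n = 1`, in which the logarithm vanishes. -/
theorem exists_grid_size (ds K : ℕ) (hK : 1 ≤ K) :
    ∃ C : ℝ, 0 ≤ C ∧ ∀ n : ℕ, 1 ≤ n → ∃ r : ℕ, K * n ≤ 2 ^ r ∧ ∀ M : ℕ, 1 ≤ M →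
      ((2 : ℝ) ^ r) ^ ds * (r + 1) ≤ C * ((n : ℝ) ^ ds * Real.log n + M) := by
  have hlog2 : 0 < Real.log 2 := Real.log_pos one_lt_two
  have hK' : (1 : ℝ) ≤ K := by exact_mod_cast hK
  have hL : 0 ≤ Real.log (4 * K) := Real.log_nonneg (by linarith)
  refine ⟨(2 * K) ^ ds * (Real.log (4 * K) * (1 + 1 / Real.log 2) + 1) / Real.log 2,
    by positivity, fun n hn => ⟨Nat.clog 2 (K * n), Nat.le_pow_clog one_lt_two _, fun M hM => ?_⟩⟩
  have hn' : (1 : ℝ) ≤ n := by exact_mod_cast hn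
  have hM' : (1 : ℝ) ≤ M := by exact_mod_cast hM
  have hKn : 1 ≤ K * n := Nat.mul_pos hK hn
  set r := Nat.clog 2 (K * n)
  have hr : 2 ^ r ≤ 2 * (K * n) := by
    rcases Nat.eq_or_lt_of_le hKn with h | h
    · simp [r, ← h]
    · have h1 := Nat.pow_pred_clog_lt_self one_lt_two h
      have h2 : 0 < r := Nat.clog_pos one_lt_two h
      obtain ⟨q, hq⟩ := Nat.exists_eq_add_of_lt h2
      change 2 ^ (r - 1) < _ at h1
      rw [hq] at h1 ⊢
      simp at h1
      rw [pow_succ, zero_add]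
      omega
  have hr' : (2 : ℝ) ^ r ≤ 2 * K * n := by
    rw [mul_assoc]
    exact_mod_cast hr
  have hlog : ((r : ℝ) + 1) * Real.log 2 ≤ Real.log (4 * K) + Real.log n := by
    rw [← Real.log_mul (by positivity) (by positivity)]
    have : ((r : ℝ) + 1) * Real.log 2 = Real.log (2 ^ (r + 1)) := by
      rw [Real.log_pow]
      push_cast
      ring
    rw [this]
    apply Real.log_le_log (by positivity)
    rw [pow_succ]
    linarith
  have hlogn : 0 ≤ Real.log n := Real.log_nonneg hn'
  have hpow : (n : ℝ) ^ ds ≤ (1 + 1 / Real.log 2) * ((n : ℝ) ^ ds * Real.log n + M) := by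
    have hX : 0 ≤ (n : ℝ) ^ ds * Real.log n := by positivity
    rcases Nat.eq_or_lt_of_le hn with h | h
    · simp only [← h, Nat.cast_one, one_pow, Real.log_one, mul_zero, zero_add]
      have : 0 < 1 / Real.log 2 := by positivity
      nlinarith
    · have h2 : Real.log 2 ≤ Real.log n := Real.log_le_log (by norm_num) (by exact_mod_cast h)
      calc (n : ℝ) ^ ds = 1 / Real.log 2 * ((n : ℝ) ^ ds * Real.log 2) := by field_simp
        _ ≤ (1 + 1 / Real.log 2) * ((n : ℝ) ^ ds * Real.log n + M) := by
          gcongr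
          · linarith
          · have : (n : ℝ) ^ ds * Real.log 2 ≤ (n : ℝ) ^ ds * Real.log n := by gcongr
            linarith
  calc ((2 : ℝ) ^ r) ^ ds * (r + 1)
      ≤ (2 * K * n) ^ ds * ((Real.log (4 * K) + Real.log n) / Real.log 2) := by
        gcongr
        rwa [le_div_iff₀ hlog2]
    _ = (2 * K) ^ ds / Real.log 2 *
        (Real.log (4 * K) * (n : ℝ) ^ ds + (n : ℝ) ^ ds * Real.log n) := by
        rw [mul_pow (2 * (K : ℝ))]
        ring
    _ ≤ (2 * K) ^ ds / Real.log 2 *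
        (Real.log (4 * K) * ((1 + 1 / Real.log 2) * ((n : ℝ) ^ ds * Real.log n + M)) +
          ((n : ℝ) ^ ds * Real.log n + M)) := by
        gcongr
        linarith
    _ = _ := by ring

/-- The cost of an iteration with the rounded system, an additional row scaling included. -/
theorem exists_near_systemMatrix_cost_le (ds : ℕ) (hds : 1 ≤ ds) (ε : ℝ) (hε : 0 < ε) :
    ∃ C : ℝ, ∀ (d : ℕ), ds ≤ d → ∀ (N : ℕ → ℕ), (∀ j ∈ Finset.Icc 1 ds, 1 ≤ N j) →
      ∀ (Nmax : ℕ), Nmax = (Finset.Icc 1 ds).sup N → ∀ (M : ℕ), 1 ≤ M →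
      ∀ x : Fin M → Fin d → ℝ, ∃ G : Matrix (Fin M) (orderIndex d ds N) ℝ,
        (∀ i k, |G i k - systemMatrix x (orderIndex d ds N) i k| ≤ ε) ∧
        ∃ a : ℕ, FastMul G a ∧
          ((6 * (M + a) + 5 * M + 9 * (orderIndex d ds N).card + 16 : ℕ) : ℝ) ≤
            C * ((d : ℝ) ^ ds * ((Nmax : ℝ) ^ ds * Real.log Nmax + M)) := by
  -- oversampling: with at least `K * Nmax` grid points the rounding error is at most `ε`
  obtain ⟨K, hK⟩ := exists_nat_ge (√2 ^ ds * (ds * (2 * Real.pi)) / ε + 1)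
  have hK0 : 0 ≤ √2 ^ ds * (ds * (2 * Real.pi)) / ε := by positivity
  have hK1 : 1 ≤ K := by
    have : (1 : ℝ) ≤ K := by linarith
    exact_mod_cast this
  obtain ⟨C, hC, hgrid⟩ := exists_grid_size ds K hK1
  refine ⟨12 * 2 ^ ds + 27 + (15 + 18 * (ds + 1)) * 2 ^ ds * C, ?_⟩
  intro d hd N hN Nmax hNmax M hM x
  have hNmax1 : 1 ≤ Nmax := by
    have h1 : 1 ∈ Finset.Icc 1 ds := Finset.mem_Icc.2 ⟨le_rfl, hds⟩
    rw [hNmax]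
    exact (hN 1 h1).trans (Finset.le_sup h1)
  obtain ⟨r, hr, hbound⟩ := hgrid Nmax hNmax1
  have hr1 : Nmax ≤ 2 ^ r := (Nat.le_mul_of_pos_left _ hK1).trans hr
  obtain ⟨G, hG, hfast⟩ := exists_fastMul_near_systemMatrix hNmax hr1 x
  refine ⟨G, fun i k => (hG i k).trans ?_, _, hfast, ?_⟩
  · have hT : (0 : ℝ) < (2 ^ r : ℕ) := by positivity
    have hr2 : (K : ℝ) * Nmax ≤ (2 ^ r : ℕ) := by exact_mod_cast hr
    have h1 : √2 ^ ds * (ds * (2 * Real.pi)) ≤ ε * K := by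
      rw [mul_comm ε, ← div_le_iff₀ hε]
      linarith
    calc √2 ^ ds * (ds * (Nmax * (2 * Real.pi / (2 ^ r : ℕ))))
        = √2 ^ ds * (ds * (2 * Real.pi)) * Nmax / (2 ^ r : ℕ) := by ring
      _ ≤ ε := by
        rw [div_le_iff₀ hT]
        nlinarith [(Nat.cast_nonneg Nmax : (0 : ℝ) ≤ Nmax)]
  · have hd1 : 1 ≤ d := hds.trans hd
    have hU : (termsUpTo d ds).card ≤ 2 ^ ds * d ^ ds := by
      rw [← mul_pow]
      exact (card_termsUpTo_le d ds).trans (Nat.pow_le_pow_left (by omega) _)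
    have hI : (orderIndex d ds N).card ≤ 2 ^ ds * d ^ ds * ((2 ^ r) ^ ds * (r + 1)) := by
      refine (card_orderIndex_le hNmax hNmax1).trans (Nat.mul_le_mul hU ?_)
      exact (Nat.pow_le_pow_left hr1 _).trans (Nat.le_mul_of_pos_right _ (by omega))
    have hD : 1 ≤ d ^ ds := Nat.one_le_pow _ _ hd1
    generalize (termsUpTo d ds).card = U at *
    generalize (orderIndex d ds N).card = I at *
    have hX : (((2 ^ r) ^ ds * (r + 1) : ℕ) : ℝ) ≤
        C * ((Nmax : ℝ) ^ ds * Real.log Nmax + M) := by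
      push_cast
      exact hbound M hM
    have hL : 0 ≤ (Nmax : ℝ) ^ ds * Real.log Nmax := by
      have := Real.log_nonneg (show (1 : ℝ) ≤ Nmax by exact_mod_cast hNmax1)
      positivity
    have hnat : 6 * (M + (M * U + (I + (M * U + U * ((ds + 1) * (2 ^ r) ^ ds * (3 * (r + 1))))))) +
        5 * M + 9 * I + 16 ≤ d ^ ds * ((12 * 2 ^ ds + 27) * M +
          (15 + 18 * (ds + 1)) * 2 ^ ds * ((2 ^ r) ^ ds * (r + 1))) := by
      have e1 : (ds + 1) * (2 ^ r) ^ ds * (3 * (r + 1)) =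
          3 * (ds + 1) * ((2 ^ r) ^ ds * (r + 1)) := by ring
      rw [e1]
      generalize (2 ^ r) ^ ds * (r + 1) = X at *
      have h1 : M * U ≤ M * (2 ^ ds * d ^ ds) := Nat.mul_le_mul_left _ hU
      have h2 : U * (3 * (ds + 1) * X) ≤ 2 ^ ds * d ^ ds * (3 * (ds + 1) * X) :=
        Nat.mul_le_mul_right _ hU
      have h3 : M ≤ d ^ ds * M := Nat.le_mul_of_pos_left _ hD
      linarith
    refine (Nat.cast_le.2 hnat).trans ?_
    push_cast at hX ⊢
    calc (d : ℝ) ^ ds * ((12 * 2 ^ ds + 27) * M +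
          (15 + 18 * (ds + 1)) * 2 ^ ds * ((2 ^ r) ^ ds * (r + 1)))
        ≤ (d : ℝ) ^ ds * ((12 * 2 ^ ds + 27) * ((Nmax : ℝ) ^ ds * Real.log Nmax + M) +
          (15 + 18 * (ds + 1)) * 2 ^ ds * (C * ((Nmax : ℝ) ^ ds * Real.log Nmax + M))) := by
          gcongr
          linarith
      _ = _ := by ring

end AnovaLSQR

end

/-- One LSQR iteration for the least-squares problem with all ANOVA terms of order at most `ds`
takes `O(d ^ ds * (Nmax ^ ds * log Nmax + M))` arithmetic operations, where `Nmax` is the largest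
of the order-dependent parameters and `M` the number of nodes. Products with the system matrix
`F` and with its transpose are carried out, as with the nonequispaced fast cosine transform and
its adjoint, with a matrix `G` that agrees with `F` up to a prescribed accuracy `ε`. The first
conjunct is the plain problem, the second the scaled and preconditioned one. -/
theorem mainTheorem7 (ds : ℕ) (hds : 1 ≤ ds) (ε : ℝ) (hε : 0 < ε) :
    ∃ C : ℝ, ∀ (d : ℕ), ds ≤ d →
      ∀ (N : ℕ → ℕ), (∀ j ∈ Finset.Icc 1 ds, 1 ≤ N j) →
      ∀ (Nmax : ℕ), Nmax = (Finset.Icc 1 ds).sup N →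
      ∀ (M : ℕ), 1 ≤ M →
      ∀ (x : Fin M → Fin d → ℝ), (∀ i s, x i s ∈ Set.Icc (-1 : ℝ) 1) →
        (∃ G : Matrix (Fin M) (AnovaLSQR.orderIndex d ds N) ℝ,
          (∀ i k, |G i k - AnovaLSQR.systemMatrix x (AnovaLSQR.orderIndex d ds N) i k| ≤ ε) ∧
          ∃ P : AnovaLSQR.Program
              (AnovaLSQR.LSQRCell (Fin M) (AnovaLSQR.orderIndex d ds N))
              (AnovaLSQR.LSQRCell (Fin M) (AnovaLSQR.orderIndex d ds N)),
            (P.cost : ℝ) ≤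
              C * ((d : ℝ) ^ ds * ((Nmax : ℝ) ^ ds * Real.log (Nmax : ℝ) + (M : ℝ))) ∧
            ∀ y : Fin M → ℝ, P.PerformsLSQR G y) ∧
        (∀ θ ∈ Set.Ioo (0 : ℝ) 1,
          ∃ G : Matrix (Fin M) (AnovaLSQR.orderIndex d ds N) ℝ,
          (∀ i k, |G i k - AnovaLSQR.systemMatrix (AnovaLSQR.scaledNodes θ x)
              (AnovaLSQR.orderIndex d ds N) i k| ≤ ε) ∧
          ∃ P : AnovaLSQR.Program
              (AnovaLSQR.LSQRCell (Fin M) (AnovaLSQR.orderIndex d ds N))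
              (AnovaLSQR.LSQRCell (Fin M) (AnovaLSQR.orderIndex d ds N)),
            (P.cost : ℝ) ≤
              C * ((d : ℝ) ^ ds * ((Nmax : ℝ) ^ ds * Real.log (Nmax : ℝ) + (M : ℝ))) ∧
            ∀ y : Fin M → ℝ,
              P.PerformsLSQR (AnovaLSQR.precond (AnovaLSQR.scaledNodes θ x) * G)
                (AnovaLSQR.precond (AnovaLSQR.scaledNodes θ x) *ᵥ y)) := by
  obtain ⟨C, hC⟩ := AnovaLSQR.exists_near_systemMatrix_cost_le ds hds ε hε
  refine ⟨C, fun d hd N hN Nmax hNmax M hM x _ => ⟨?_, fun θ _ => ?_⟩⟩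
  · obtain ⟨G, hG, a, ha, hcost⟩ := hC d hd N hN Nmax hNmax M hM x
    obtain ⟨P, hP, hPL⟩ := AnovaLSQR.exists_program_lsqr ha
    refine ⟨G, hG, P, le_trans (Nat.cast_le.2 ?_) hcost, hPL⟩
    rw [Fintype.card_fin, Fintype.card_coe] at hP
    omega
  · obtain ⟨G, hG, a, ha, hcost⟩ := hC d hd N hN Nmax hNmax M hM (AnovaLSQR.scaledNodes θ x)
    obtain ⟨P, hP, hPL⟩ := AnovaLSQR.exists_program_lsqr (AnovaLSQR.FastMul.mul
      (AnovaLSQR.precond (AnovaLSQR.scaledNodes θ x)) G _ _ (AnovaLSQR.FastMul.diagonal _) ha)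
    refine ⟨G, hG, P, le_trans (Nat.cast_le.2 ?_) hcost, fun y => hPL _⟩
    rw [Fintype.card_fin, Fintype.card_coe] at hP
    omega
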